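/- Let $\xi=\{\xi(k)\}_{k\in\mathbb Z}$ be i.i.d. non-negative square-integrable random variables on a probability space, with $\lambda_1=\mathbb E[\xi(0)]>0$ and $\sigma=\mathrm{Var}[\xi(0)]^{1/2}>0$. Let $a>0$, and let $b(j)\ge 0$ for $j\ge 1$, with $b(j)\neq 0$ for at least one $j$. Let $X=\{X(k)\}_{k\in\mathbb Z}$ be a weakly stationary solution (finite variances, constant mean, covariances depending only on the lag) of the ARCH($\infty$) equations $$X(k)=\varsigma(k)\,\xi(k),\qquad \varsigma(k)=a+\sum_{j=1}^{\infty}b(j)X(k-j)\qquad(k\in\mathbb Z)\quad\text{a.s.},$$ which is non-anticipative: for each $k$, $\xi(k)$ is independent of $\{X(j)\}_{j<k}$. Let $\rho(k)=\mathrm{Cov}[X(n),X(n+k)]$ be its autocovariance function. Assume (S1) $\lambda_1\sum_{j=1}^\infty b(j)<1$; (S2) $\displaystyle\frac{\sigma}{\lambda_1}\Bigl(\sum_{j=1}^\infty z(j)^2\Bigr)^{1/2}<1$, where the real sequence $z$ is defined by $\displaystyle\frac{1}{1-\lambda_1\sum_{j=1}^\infty b(j)w^j}=\sum_{j=0}^\infty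 z(j)w^j$ for complex $|w|\le 1$. For $r>0$ let $\mathcal W(r)$ be the set of positive sequences $\gamma=\{\gamma(n)\}_{n\ge0}$ with $$\lim_{n\to\infty}\frac{\gamma(n-1)}{\gamma(n)}=\frac1r,\qquad \sum_{i=0}^\infty\gamma(i)r^{-i}<\infty,\qquad \lim_{m\to\infty}\Bigl(\limsup_{n\to\infty}\frac1{\gamma(n)}\sum_{i=m}^{n-m}\gamma(n-i)\gamma(i)\Bigr)=0,$$ and let $\mathcal W^{\downarrow}(r)$ be the set of $\gamma\in\mathcal W(r)$ for which there is a positive non-increasing sequence $g$ with $\gamma(n)/g(n)\to1$ as $n\to\infty$. Let $r\in(0,1]$ and $\gamma\in\mathcal W^{\downarrow}(r)$. Then the following are equivalent: (a) $\lambda_1\sum_{j=1}^\infty b(j)r^{-j}<1$ (in particular the series converges), and there exists $C_0\in(0,\infty)$ such that $b(n)\le C_0\gamma(n)$ for all $n\ge1$; (b) there exists $C_2\in(0,\infty)$ such that $\rho(n)\le C_2\gamma(n)$ for all $n\ge0$. -/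

import Mathlib

open MeasureTheory ProbabilityTheory Filter Topology

/-- The class `W(r)` of weight sequences. The upper limit is taken in `[0, ∞]`, so that an
unbounded quotient has upper limit `∞`. -/
structure InW (r : ℝ) (γ : ℕ → ℝ) : Prop where
  pos : ∀ n, 0 < γ n
  ratio : Tendsto (fun n : ℕ => γ n / γ (n + 1)) atTop (𝓝 (1 / r))
  summable : Summable (fun i : ℕ => γ i / r ^ i)
  tail : Tendsto
    (fun m : ℕ => limsup
      (fun n : ℕ => ENNReal.ofReal ((∑ i ∈ Finset.Icc m (n - m), γ (n - i) * γ i) / γ n)) atTop)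
    atTop (𝓝 0)

/-- The class `W^↓(r)`: members of `W(r)` asymptotic to a positive non-increasing sequence. -/
def InWDown (r : ℝ) (g : ℕ → ℝ) : Prop :=
  InW r g ∧ ∃ γ : ℕ → ℝ, (∀ n, 0 < γ n) ∧ (∀ n, γ (n + 1) ≤ γ n) ∧
    Tendsto (fun n => g n / γ n) atTop (𝓝 1)

/-- An i.i.d. sequence of non-negative, square-integrable random variables
(the shocks), indexed by the integers. -/
structure IsShockSequence {Ω : Type*} [MeasurableSpace Ω] (P : Measure Ω)
    (ξ : ℤ → Ω → ℝ) : Prop where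
  measurable : ∀ k, Measurable (ξ k)
  nonneg : ∀ k, ∀ᵐ ω ∂P, 0 ≤ ξ k ω
  indep : iIndepFun ξ P
  identDistrib : ∀ k, IdentDistrib (ξ k) (ξ 0) P P
  memLp : MemLp (ξ 0) 2 P

/-- `X` solves the ARCH(∞) equations
`X(k) = ς(k) ξ(k)`, `ς(k) = a + ∑_{j ≥ 1} b(j) X(k - j)` almost surely, and is non-anticipative:
`ξ(k)` is independent of the past `(X(j))_{j < k}`. The value `b 0` is never used. -/
structure IsArchSolution {Ω : Type*} [MeasurableSpace Ω] (P : Measure Ω)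
    (a : ℝ) (b : ℕ → ℝ) (ξ X : ℤ → Ω → ℝ) : Prop where
  measurable : ∀ k, Measurable (X k)
  summable : ∀ k : ℤ, ∀ᵐ ω ∂P, Summable (fun j : ℕ => b (j + 1) * X (k - (j + 1)) ω)
  equation : ∀ k : ℤ, ∀ᵐ ω ∂P,
    X k ω = (a + ∑' j : ℕ, b (j + 1) * X (k - (j + 1)) ω) * ξ k ω
  nonanticipative : ∀ k : ℤ, IndepFun (ξ k) (fun ω (j : {j : ℤ // j < k}) => X j ω) P

/-- `X` is weakly stationary with autocovariance function `ρ`. -/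
structure IsWeaklyStationary {Ω : Type*} [MeasurableSpace Ω] (P : Measure Ω)
    (X : ℤ → Ω → ℝ) (ρ : ℤ → ℝ) : Prop where
  memLp : ∀ k, MemLp (X k) 2 P
  mean : ∃ m : ℝ, ∀ k, ∫ ω, X k ω ∂P = m
  cov : ∀ n k : ℤ, ρ k = covariance (X n) (X (n + k)) P

/-- `c * ∑_{j ≥ 1} b(j) r^{-j} < 1`, convergence of the series included. -/
def WeightedSumLtOne (c : ℝ) (b : ℕ → ℝ) (r : ℝ) : Prop :=
  Summable (fun j : ℕ => b (j + 1) / r ^ (j + 1)) ∧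
    c * ∑' j : ℕ, b (j + 1) / r ^ (j + 1) < 1

/-- `z` is the coefficient sequence of `1 / (1 - c ∑_{j ≥ 1} b(j) w^j)` on `|w| ≤ 1`. -/
def IsReciprocalCoeffs (c : ℝ) (b z : ℕ → ℝ) : Prop :=
  ∀ w : ℂ, ‖w‖ ≤ 1 →
    HasSum (fun j : ℕ => (z j : ℂ) * w ^ j)
      (1 / (1 - (c : ℂ) * ∑' j : ℕ, (b (j + 1) : ℂ) * w ^ (j + 1)))

/-! Write `β j = lam1 * b (j + 1)`. The reciprocal coefficients `z` solve the renewal equation with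
kernel `β`, so `z` is non-negative and dominates a shift of `β`. Non-anticipation gives the
Yule-Walker equations for `ρ` at lags `k ≥ 0`, with an extra term `v = Var ξ · E ς² > 0` at lag
zero. The sequence `v * autocorr z` solves the same equations. The difference is bounded, even and
homogeneous, and the total mass of `β` is below one, so it vanishes: `ρ = v * autocorr z`
(`IsRenewal.eq_autocorr`).

What remains is deterministic (`IsRenewal.weight_iff`). If `β` is dominated by the weight and its
mass at `1 / r` is below one, then so is `z` dominated (`IsRenewal.exists_le_weight`);
almost-monotonicity of the weight passes this to the autocorrelation. Conversely `β n ≤ z (n + 1)`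
and `z n ≤ autocorr z n`, so a bound on `ρ` bounds both; summability of `γ i / r ^ i` makes the
series of `z` converge at `1 / r`, and the identity `Z = 1 + B Z` forces `B < 1` there. -/

/-! ### Coefficients of the reciprocal power series. -/

/-- Uniqueness of the coefficients of a power series with sum `1` on the closed unit disc. -/
theorem coeff_eq_of_hasSum_one {d : ℕ → ℂ}
    (h : ∀ w : ℂ, ‖w‖ ≤ 1 → HasSum (fun n => d n * w ^ n) 1) (n : ℕ) :
    d n = if n = 0 then 1 else 0 := by
  have key : ∀ e : ℕ → ℂ, (∀ w : ℂ, ‖w‖ ≤ 1 → HasSum (fun n => e n * w ^ n) 1) →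
      HasFPowerSeriesOnBall (fun _ : ℂ => (1 : ℂ))
        (FormalMultilinearSeries.ofScalars ℂ e) 0 1 := by
    intro e he
    refine ⟨?_, one_pos, ?_⟩
    · have hs : Summable (fun n => ‖e n‖) := by
        simpa using (he 1 (by simp)).summable.norm
      have := FormalMultilinearSeries.le_radius_of_summable_norm
        (FormalMultilinearSeries.ofScalars ℂ e) (r := 1) (by
          simpa [FormalMultilinearSeries.ofScalars_norm] using hs)
      simpa using this
    · intro y hy
      have hy' : ‖y‖ ≤ 1 := by
        have : ‖y‖ₑ < 1 := by simpa using hy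
        have := (enorm_lt_coe (r := 1)).1 (by simpa using this)
        exact le_of_lt (by exact_mod_cast this)
      simpa [FormalMultilinearSeries.ofScalars_apply_eq, mul_comm] using he y hy'
  have h2 := key (fun n => if n = 0 then 1 else 0) (by
    intro w _
    have h0 : (fun n : ℕ => (if n = 0 then (1 : ℂ) else 0) * w ^ n)
        = fun n => if n = 0 then 1 else 0 := by
      ext n
      split_ifs with hn <;> simp [hn]
    rw [h0]
    exact hasSum_ite_eq (0 : ℕ) (1 : ℂ))
  have h3 := (key d h).hasFPowerSeriesAt.eq_formalMultilinearSeries h2.hasFPowerSeriesAt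
  have := (FormalMultilinearSeries.ofScalars_series_injective ℂ ℂ) h3
  exact congrFun this n

theorem IsReciprocalCoeffs.summable {c : ℝ} {b z : ℕ → ℝ} (hz : IsReciprocalCoeffs c b z) :
    Summable z := by
  have := (hz 1 (by simp)).summable
  simp only [one_pow, mul_one] at this
  exact_mod_cast this

/-- The Cauchy product of `1 - c ∑ b(j) w^j` with its reciprocal is `1` on the disc; comparing
coefficients gives the recursion. -/
theorem IsReciprocalCoeffs.rec {c : ℝ} {b z : ℕ → ℝ} (hz : IsReciprocalCoeffs c b z)
    (hc : 0 ≤ c) (hb : ∀ j, 1 ≤ j → 0 ≤ b j) (hs : Summable fun j : ℕ => b (j + 1))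
    (hlt : c * ∑' j : ℕ, b (j + 1) < 1) :
    z 0 = 1 ∧ ∀ n, z (n + 1) = ∑ j ∈ Finset.range (n + 1), c * b (j + 1) * z (n - j) := by
  -- Coefficients of the denominator; the constant term is set to `1` by hand because `b 0` is
  -- arbitrary.
  let e : ℕ → ℂ := fun n => if n = 0 then 1 else -((c * b n : ℝ) : ℂ)
  have hbw : ∀ w : ℂ, ‖w‖ ≤ 1 → ∀ j : ℕ, ‖(b (j + 1) : ℂ) * w ^ (j + 1)‖ ≤ b (j + 1) := by
    intro w hw j
    rw [norm_mul, norm_pow, Complex.norm_real, Real.norm_of_nonneg (hb _ (by omega))]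
    exact mul_le_of_le_one_right (hb _ (by omega)) (pow_le_one₀ (norm_nonneg _) hw)
  have hsw : ∀ w : ℂ, ‖w‖ ≤ 1 → Summable fun j : ℕ => ‖(b (j + 1) : ℂ) * w ^ (j + 1)‖ :=
    fun w hw => hs.of_nonneg_of_le (fun _ => norm_nonneg _) (hbw w hw)
  have hne : ∀ w : ℂ, ‖w‖ ≤ 1 →
      1 - (c : ℂ) * ∑' j : ℕ, (b (j + 1) : ℂ) * w ^ (j + 1) ≠ 0 := by
    intro w hw h0
    have h1 : (c : ℂ) * ∑' j : ℕ, (b (j + 1) : ℂ) * w ^ (j + 1) = 1 := (sub_eq_zero.1 h0).symm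
    have h2 : ‖∑' j : ℕ, (b (j + 1) : ℂ) * w ^ (j + 1)‖ ≤ ∑' j : ℕ, b (j + 1) :=
      tsum_of_norm_bounded hs.hasSum (hbw w hw)
    have h3 := congrArg norm h1
    rw [norm_mul, Complex.norm_real, Real.norm_of_nonneg hc, norm_one] at h3
    nlinarith
  have heS : ∀ w : ℂ, ‖w‖ ≤ 1 → Summable (fun n => ‖e n * w ^ n‖) ∧
      ∑' n, e n * w ^ n = 1 - (c : ℂ) * ∑' j : ℕ, (b (j + 1) : ℂ) * w ^ (j + 1) := by
    intro w hw
    have hterm : ∀ j : ℕ, e (j + 1) * w ^ (j + 1)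
        = -(c : ℂ) * ((b (j + 1) : ℂ) * w ^ (j + 1)) := by
      intro j; simp [e]; ring
    have h1 : Summable (fun n => ‖e n * w ^ n‖) := by
      rw [← summable_nat_add_iff 1]
      simp only [hterm, norm_mul (-(c : ℂ))]
      exact (hsw w hw).mul_left _
    refine ⟨h1, ?_⟩
    rw [h1.of_norm.tsum_eq_zero_add]
    simp only [hterm, tsum_mul_left]
    simp [e]; ring
  have hd : ∀ w : ℂ, ‖w‖ ≤ 1 → HasSum
      (fun n => (∑ k ∈ Finset.range (n + 1), e k * (z (n - k) : ℂ)) * w ^ n) 1 := by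
    intro w hw
    have hz' := (hz w hw).summable.norm
    have h1 := tsum_mul_tsum_eq_tsum_sum_range_of_summable_norm (heS w hw).1 hz'
    have h2 := (summable_norm_sum_mul_range_of_summable_norm (heS w hw).1 hz').of_norm
    rw [(heS w hw).2, (hz w hw).tsum_eq, mul_one_div_cancel (hne w hw)] at h1
    have h3 := h2.hasSum
    rw [← h1] at h3
    refine Eq.subst (motive := fun f : ℕ → ℂ => HasSum f 1) (funext fun n => ?_) h3
    rw [Finset.sum_mul]
    refine Finset.sum_congr rfl fun k hk => ?_
    have : n = k + (n - k) := by have := Finset.mem_range.1 hk; omega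
    conv_rhs => rw [this, pow_add, ← this]
    ring
  have hcoef := coeff_eq_of_hasSum_one hd
  constructor
  · have := hcoef 0
    simp [e] at this
    exact_mod_cast this
  · intro n
    have := hcoef (n + 1)
    rw [Finset.sum_range_succ'] at this
    simp only [e, Nat.add_sub_add_right, if_neg (Nat.succ_ne_zero _), if_true, one_mul,
      Nat.sub_zero, neg_mul, Finset.sum_neg_distrib] at this
    have h : ((z (n + 1) : ℝ) : ℂ)
        = ((∑ j ∈ Finset.range (n + 1), c * b (j + 1) * z (n - j) : ℝ) : ℂ) := by
      push_cast at this ⊢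
      linear_combination this
    exact_mod_cast h

/-! ### Renewal equations. -/

/-- The renewal equation `z(n+1) = ∑_{j ≤ n} β(j) z(n-j)`, `z(0) = 1`. -/
def IsRenewal (β z : ℕ → ℝ) : Prop :=
  z 0 = 1 ∧ ∀ n, z (n + 1) = ∑ j ∈ Finset.range (n + 1), β j * z (n - j)

theorem IsRenewal.nonneg {β z : ℕ → ℝ} (h : IsRenewal β z) (hβ : ∀ j, 0 ≤ β j) (n : ℕ) :
    0 ≤ z n := by
  induction n using Nat.strong_induction_on with
  | _ n ih =>
    rcases n with _ | n
    · rw [h.1]; exact zero_le_one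
    · rw [h.2]
      exact Finset.sum_nonneg fun j _ => mul_nonneg (hβ j) (ih _ (by omega))

theorem IsRenewal.le {β z : ℕ → ℝ} (h : IsRenewal β z) (hβ : ∀ j, 0 ≤ β j) (n : ℕ) :
    β n ≤ z (n + 1) := by
  rw [h.2]
  have := Finset.single_le_sum (f := fun j => β j * z (n - j)) (s := Finset.range (n + 1))
    (fun j _ => mul_nonneg (hβ j) (h.nonneg hβ _)) (Finset.self_mem_range_succ n)
  simpa [h.1] using this

/-- The generating function of the kernel of a renewal equation is `< 1` wherever that of the
solution converges. -/
theorem IsRenewal.tsum_lt_one {β z : ℕ → ℝ} (h : IsRenewal β z) (hβ : ∀ j, 0 ≤ β j) {x : ℝ}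
    (hx : 0 < x) (hs : Summable fun n => z n * x ^ n) :
    Summable (fun n => β n * x ^ (n + 1)) ∧ ∑' n, β n * x ^ (n + 1) < 1 := by
  have hz := h.nonneg hβ
  have hs1 : Summable fun n => z (n + 1) * x ^ (n + 1) := (summable_nat_add_iff 1).2 hs
  have hβs : Summable (fun n => β n * x ^ (n + 1)) :=
    hs1.of_nonneg_of_le (fun n => mul_nonneg (hβ n) (by positivity))
      fun n => mul_le_mul_of_nonneg_right (h.le hβ n) (by positivity)
  refine ⟨hβs, ?_⟩
  have h1 := tsum_mul_tsum_eq_tsum_sum_range_of_summable_norm hβs.norm hs.norm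
  have h2 : ∀ n, ∑ k ∈ Finset.range (n + 1), β k * x ^ (k + 1) * (z (n - k) * x ^ (n - k))
      = z (n + 1) * x ^ (n + 1) := by
    intro n
    rw [h.2, Finset.sum_mul]
    refine Finset.sum_congr rfl fun k hk => ?_
    have : n + 1 = (k + 1) + (n - k) := by have := Finset.mem_range.1 hk; omega
    rw [this, pow_add]; ring
  simp only [h2] at h1
  have h3 := hs.tsum_eq_zero_add
  rw [h.1] at h3
  have h4 : 0 ≤ ∑' n, z (n + 1) * x ^ (n + 1) :=
    tsum_nonneg fun n => mul_nonneg (hz _) (by positivity)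
  -- With `Z` and `B` the generating functions at `x`, `h1` and `h3` say `Z = 1 + B Z` with `Z ≥ 1`,
  -- which is impossible for `B ≥ 1`.
  by_contra hcon
  push Not at hcon
  simp only [pow_zero, mul_one] at h3
  nlinarith

/-! ### Autocorrelation and the Yule-Walker equations. -/

/-- Extension of a sequence by zero to the negative integers. -/
def zeroExtend (z : ℕ → ℝ) (n : ℤ) : ℝ := if 0 ≤ n then z n.toNat else 0

@[simp] theorem zeroExtend_natCast (z : ℕ → ℝ) (n : ℕ) : zeroExtend z n = z n := by
  simp [zeroExtend]

theorem zeroExtend_of_neg (z : ℕ → ℝ) {n : ℤ} (h : n < 0) : zeroExtend z n = 0 := by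
  simp [zeroExtend, not_le.2 h]

theorem summable_zeroExtend {z : ℕ → ℝ} (h : Summable z) : Summable (zeroExtend z) := by
  have hi : Function.Injective (fun n : ℕ => (n : ℤ)) := Nat.cast_injective
  rw [← hi.summable_iff]
  · convert h using 1; ext n; simp
  · intro n hn
    refine zeroExtend_of_neg z ?_
    by_contra h0
    exact hn ⟨n.toNat, by simp; omega⟩

theorem tsum_zeroExtend_mul (z : ℕ → ℝ) (f : ℤ → ℝ) :
    ∑' n : ℤ, zeroExtend z n * f n = ∑' n : ℕ, z n * f n := by
  have hi : Function.Injective (fun n : ℕ => (n : ℤ)) := Nat.cast_injective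
  rw [← hi.tsum_eq]
  · simp
  · intro n hn
    by_contra h0
    have : n < 0 := by
      by_contra h1
      exact h0 ⟨n.toNat, by simp; omega⟩
    exact hn (by simp [zeroExtend_of_neg z this])

theorem IsRenewal.zeroExtend_eq {β z : ℕ → ℝ} (h : IsRenewal β z) (n : ℤ) :
    zeroExtend z n = (if n = 0 then 1 else 0) +
      ∑' j : ℕ, β j * zeroExtend z (n - (j + 1)) := by
  have hfin : ∑' j : ℕ, β j * zeroExtend z (n - (j + 1))
      = ∑ j ∈ Finset.range n.toNat, β j * zeroExtend z (n - (j + 1)) := by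
    refine tsum_eq_sum fun j hj => ?_
    rw [zeroExtend_of_neg z, mul_zero]
    simp at hj; omega
  rw [hfin]
  rcases lt_trichotomy n 0 with hn | rfl | hn
  · have : n.toNat = 0 := by omega
    simp [zeroExtend_of_neg z hn, this, hn.ne]
  · simp [zeroExtend, h.1]
  · obtain ⟨m, rfl⟩ : ∃ m : ℕ, n = (m + 1 : ℕ) := ⟨n.toNat - 1, by omega⟩
    rw [zeroExtend_natCast, h.2, if_neg hn.ne', zero_add, Int.toNat_natCast]
    refine Finset.sum_congr rfl fun j hj => ?_
    have hj := Finset.mem_range.1 hj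
    have : ((m + 1 : ℕ) : ℤ) - (j + 1) = ((m - j : ℕ) : ℤ) := by omega
    rw [this, zeroExtend_natCast]

/-- The two-sided autocorrelation `∑_i z(i) z(i+k)` of a one-sided sequence. -/
noncomputable def autocorr (z : ℕ → ℝ) (k : ℤ) : ℝ :=
  ∑' i : ℤ, zeroExtend z i * zeroExtend z (i + k)

theorem autocorr_natCast (z : ℕ → ℝ) (k : ℕ) : autocorr z k = ∑' i : ℕ, z i * z (i + k) := by
  rw [autocorr, tsum_zeroExtend_mul]
  refine tsum_congr fun i => ?_
  rw [← Nat.cast_add, zeroExtend_natCast]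

theorem autocorr_neg (z : ℕ → ℝ) (k : ℤ) : autocorr z (-k) = autocorr z k := by
  rw [autocorr, autocorr, ← (Equiv.addRight k).tsum_eq]
  refine tsum_congr fun i => ?_
  simp [mul_comm]

theorem exists_bound_of_summable {ι : Type*} {f : ι → ℝ} (h : Summable f) :
    ∃ M, ∀ i, |f i| ≤ M :=
  ⟨∑' i, |f i|, fun i => h.norm.le_tsum i fun _ _ => abs_nonneg _⟩

theorem summable_mul_bounded {ι : Type*} {f g : ι → ℝ} {M : ℝ} (h : Summable f)
    (hg : ∀ i, |g i| ≤ M) : Summable fun i => f i * g i := by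
  refine Summable.of_norm_bounded (h.norm.mul_right M) fun i => ?_
  rw [norm_mul]
  exact mul_le_mul_of_nonneg_left (hg i) (norm_nonneg _)

theorem abs_autocorr_le {z : ℕ → ℝ} (hz : Summable z) : ∃ M, ∀ k, |autocorr z k| ≤ M := by
  have hs := summable_zeroExtend hz
  obtain ⟨M, hM⟩ := exists_bound_of_summable hs
  refine ⟨∑' i, |zeroExtend z i| * M, fun k => ?_⟩
  rw [autocorr, ← Real.norm_eq_abs]
  refine tsum_of_norm_bounded (hs.norm.mul_right M).hasSum fun i => ?_
  rw [norm_mul]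
  exact mul_le_mul_of_nonneg_left (hM _) (norm_nonneg _)

/-- Insert the renewal equation on `ℤ` for the factor at `i + k` and interchange the sums; the unit
mass at `i + k = 0` leaves `zeroExtend z (-k)`. -/
theorem IsRenewal.autocorr_eq {β z : ℕ → ℝ} (h : IsRenewal β z) (hβ : Summable β)
    (hz : Summable z) (k : ℤ) :
    autocorr z k = zeroExtend z (-k) + ∑' j : ℕ, β j * autocorr z (k - (j + 1)) := by
  have hs := summable_zeroExtend hz
  obtain ⟨M, hM⟩ := exists_bound_of_summable hs
  have hdouble : Summable (Function.uncurry fun (i : ℤ) (j : ℕ) =>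
      zeroExtend z i * (β j * zeroExtend z (i + k - (j + 1)))) := by
    have := (summable_mul_of_summable_norm hs.norm hβ.norm)
    refine (summable_mul_bounded this (g := fun p : ℤ × ℕ => zeroExtend z (p.1 + k - (p.2 + 1)))
      (fun p => hM _)).congr fun p => ?_
    simp [Function.uncurry, mul_assoc]
  have hswap : ∑' j : ℕ, β j * autocorr z (k - (j + 1))
      = ∑' i : ℤ, zeroExtend z i * ∑' j : ℕ, β j * zeroExtend z (i + k - (j + 1)) := by
    simp_rw [autocorr, ← tsum_mul_left]
    rw [← hdouble.tsum_comm]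
    refine tsum_congr fun j => tsum_congr fun i => ?_
    rw [add_sub_assoc]; ring
  rw [hswap]
  have hdelta : ∑' i : ℤ, zeroExtend z i * (if i + k = 0 then 1 else 0) = zeroExtend z (-k) := by
    rw [tsum_eq_single (-k)]
    · simp
    · intro i hi
      rw [if_neg (by omega), mul_zero]
  rw [← hdelta, ← Summable.tsum_add]
  · refine tsum_congr fun i => ?_
    rw [← mul_add, ← h.zeroExtend_eq]
  · refine summable_of_ne_finset_zero (s := {-k}) fun i hi => ?_
    rw [if_neg (by simp at hi; omega), mul_zero]
  · refine hdouble.prod.congr fun i => ?_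
    simp [Function.uncurry, tsum_mul_left]

/-- Bounded even solutions of the Yule-Walker equations vanish. -/
theorem eq_zero_of_homogeneous {β : ℕ → ℝ} (hβ0 : ∀ j, 0 ≤ β j) (hβ : Summable β)
    (hlt : ∑' j, β j < 1) {d : ℤ → ℝ} {M : ℝ} (hM : ∀ k, |d k| ≤ M) (heven : ∀ k, d (-k) = d k)
    (hd : ∀ k : ℤ, 0 ≤ k → d k = ∑' j : ℕ, β j * d (k - (j + 1))) (k : ℤ) : d k = 0 := by
  set B := ∑' j, β j with hB
  have hB0 : 0 ≤ B := tsum_nonneg hβ0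
  -- Each pass improves a uniform bound by the factor `B < 1`. Evenness supplies the negative lags,
  -- where no equation is available.
  have step : ∀ N : ℝ, (∀ k, |d k| ≤ N) → ∀ k, |d k| ≤ B * N := by
    intro N hN
    have hpos : ∀ k : ℤ, 0 ≤ k → |d k| ≤ B * N := by
      intro k hk
      rw [hd k hk, ← Real.norm_eq_abs]
      refine tsum_of_norm_bounded (hβ.hasSum.mul_right N) fun j => ?_
      rw [norm_mul, Real.norm_of_nonneg (hβ0 j)]
      exact mul_le_mul_of_nonneg_left (hN _) (hβ0 j)
    intro k
    rcases le_total 0 k with hk | hk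
    · exact hpos k hk
    · rw [← heven]; exact hpos _ (by omega)
  have hpow : ∀ n : ℕ, ∀ k, |d k| ≤ B ^ n * M := by
    intro n
    induction n with
    | zero => simpa using hM
    | succ n ih =>
      intro k
      rw [pow_succ', mul_assoc]
      exact step _ ih k
  have hlim : Tendsto (fun n : ℕ => B ^ n * M) atTop (𝓝 (0 * M)) :=
    (tendsto_pow_atTop_nhds_zero_of_lt_one hB0 hlt).mul_const M
  have := ge_of_tendsto' hlim fun n => hpow n k
  rw [zero_mul] at this
  exact abs_nonpos_iff.1 this

theorem IsRenewal.eq_autocorr {β z : ℕ → ℝ} (h : IsRenewal β z) (hβ0 : ∀ j, 0 ≤ β j)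
    (hβ : Summable β) (hlt : ∑' j, β j < 1) (hz : Summable z) {ρ : ℤ → ℝ} {M v : ℝ}
    (hM : ∀ k, |ρ k| ≤ M) (heven : ∀ k, ρ (-k) = ρ k)
    (hρ : ∀ k : ℤ, 0 ≤ k →
      ρ k = (if k = 0 then v else 0) + ∑' j : ℕ, β j * ρ (k - (j + 1))) (k : ℤ) :
    ρ k = v * autocorr z k := by
  obtain ⟨N, hN⟩ := abs_autocorr_le hz
  refine sub_eq_zero.1 (eq_zero_of_homogeneous hβ0 hβ hlt (d := fun k => ρ k - v * autocorr z k)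
    (M := M + |v| * N) ?_ ?_ ?_ k)
  · intro k
    refine (abs_sub _ _).trans ?_
    rw [abs_mul]
    exact add_le_add (hM k) (mul_le_mul_of_nonneg_left (hN k) (abs_nonneg v))
  · intro k
    simp only [heven, autocorr_neg]
  · intro k hk
    have h1 : Summable fun j : ℕ => β j * ρ (k - (j + 1)) := summable_mul_bounded hβ fun _ => hM _
    have h2 : Summable fun j : ℕ => β j * autocorr z (k - (j + 1)) :=
      summable_mul_bounded hβ fun _ => hN _
    -- The boundary term is a unit mass at zero only because `k ≥ 0`.
    have h3 : zeroExtend z (-k) = if k = 0 then 1 else 0 := by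
      split_ifs with hk0
      · subst hk0; simp [zeroExtend, h.1]
      · exact zeroExtend_of_neg z (by omega)
    have h4 : ∑' j : ℕ, β j * (ρ (k - (j + 1)) - v * autocorr z (k - (j + 1)))
        = (∑' j : ℕ, β j * ρ (k - (j + 1))) - v * ∑' j : ℕ, β j * autocorr z (k - (j + 1)) := by
      rw [← tsum_mul_left, ← h1.tsum_sub (h2.mul_left v)]
      exact tsum_congr fun j => by ring
    simp only [h4]
    rw [h.autocorr_eq hβ hz k, h3]
    conv_lhs => rw [hρ k hk]
    split_ifs <;> ring

/-! ### Weights and the transfer of decay. -/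

theorem InW.tendsto_ratio {r : ℝ} {γ : ℕ → ℝ} (h : InW r γ) (j : ℕ) :
    Tendsto (fun n => γ (n - j) / γ n) atTop (𝓝 (1 / r ^ j)) := by
  rw [← tendsto_add_atTop_iff_nat j]
  simp only [Nat.add_sub_cancel]
  induction j with
  | zero => simp [div_self (h.pos _).ne']
  | succ j ih =>
    have h1 := ih.mul (h.ratio.comp (tendsto_add_atTop_nat j))
    have h2 : 1 / r ^ j * (1 / r) = 1 / r ^ (j + 1) := by rw [pow_succ]; ring
    rw [h2] at h1
    refine h1.congr fun n => ?_
    have := (h.pos (n + j)).ne'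
    simp only [Function.comp_apply, ← add_assoc]
    field_simp

/-- The cutoff is `p + 1`, so that these are exactly the intermediate lags in `IsRenewal.eq_split`.
-/
theorem InW.exists_tail_lt {r : ℝ} {γ : ℕ → ℝ} (h : InW r γ) {ε : ℝ} (hε : 0 < ε) :
    ∃ p : ℕ, ∀ᶠ n in atTop,
      ∑ i ∈ Finset.Icc (p + 1) (n - (p + 1)), γ (n - i) * γ i ≤ ε * γ n := by
  have h1 := h.tail.eventually (gt_mem_nhds (ENNReal.ofReal_pos.2 hε))
  obtain ⟨m, hm⟩ := eventually_atTop.1 h1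
  refine ⟨m, ?_⟩
  filter_upwards [eventually_lt_of_limsup_lt (hm (m + 1) (by omega))] with n hn
  have h2 := (ENNReal.ofReal_lt_ofReal_iff hε).1 hn
  exact ((div_lt_iff₀ (h.pos n)).1 h2).le

/-- Splitting of a renewal sum into recent, intermediate and remote lags. -/
theorem IsRenewal.eq_split {β z : ℕ → ℝ} (h : IsRenewal β z) {n p : ℕ} (hn : 2 * (p + 1) ≤ n) :
    z n = ∑ j ∈ Finset.range p, β j * z (n - (j + 1)) +
      ∑ j ∈ Finset.Ico p (n - (p + 1)), β j * z (n - (j + 1)) +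
      ∑ i ∈ Finset.range (p + 1), β (n - (i + 1)) * z i := by
  obtain ⟨m, rfl⟩ : ∃ m, n = m + 1 := ⟨n - 1, by omega⟩
  have h1 : ∑ i ∈ Finset.range (p + 1), β (m + 1 - (i + 1)) * z i
      = ∑ j ∈ Finset.Ico (m + 1 - (p + 1)) (m + 1), β j * z (m + 1 - (j + 1)) := by
    refine Finset.sum_nbij' (fun i => m - i) (fun j => m - j) ?_ ?_ ?_ ?_ ?_
    · intro i hi; simp at hi ⊢; omega
    · intro i hi; simp at hi ⊢; omega
    · intro i hi; simp at hi ⊢; omega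
    · intro i hi; simp at hi ⊢; omega
    · intro i hi
      have := Finset.mem_range.1 hi
      have h2 : m + 1 - (m - i + 1) = i := by omega
      rw [h2, Nat.add_sub_add_right]
  rw [h1, Finset.range_eq_Ico, Finset.sum_Ico_consecutive _ (by omega) (by omega),
    Finset.sum_Ico_consecutive _ (by omega) (by omega), h.2, Finset.range_eq_Ico]
  simp only [Nat.add_sub_add_right]

/-- The solution of a renewal equation inherits a weight in `W(r)` from its kernel. -/
theorem IsRenewal.exists_le_weight {β z γ : ℕ → ℝ} {r C : ℝ} (h : IsRenewal β z)
    (hγ : InW r γ) (hr : 0 < r) (hβ0 : ∀ j, 0 ≤ β j)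
    (hs : Summable fun j => β j / r ^ (j + 1)) (hlt : ∑' j, β j / r ^ (j + 1) < 1)
    (hC0 : 0 < C) (hC : ∀ j, β j ≤ C * γ (j + 1)) :
    ∃ K, 0 < K ∧ ∀ n, z n ≤ K * γ n := by
  have hz := h.nonneg hβ0
  set q₀ := ∑' j, β j / r ^ (j + 1) with hq₀
  -- Recent lags will cost `q₀ + δ` and intermediate ones `δ`; the total `q₀ + 2 * δ` stays below
  -- one.
  set δ := (1 - q₀) / 4 with hδ
  have hδ0 : 0 < δ := by rw [hδ]; linarith
  obtain ⟨p, hp⟩ := hγ.exists_tail_lt (div_pos hδ0 hC0)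
  have hrec : ∀ᶠ n in atTop, ∑ j ∈ Finset.range p, β j * γ (n - (j + 1)) ≤ (q₀ + δ) * γ n := by
    have h1 : Tendsto (fun n => ∑ j ∈ Finset.range p, β j * (γ (n - (j + 1)) / γ n)) atTop
        (𝓝 (∑ j ∈ Finset.range p, β j * (1 / r ^ (j + 1)))) :=
      tendsto_finsetSum _ fun j _ => (hγ.tendsto_ratio (j + 1)).const_mul (β j)
    have h2 : ∑ j ∈ Finset.range p, β j * (1 / r ^ (j + 1)) < q₀ + δ := by
      have := hs.sum_le_tsum (Finset.range p) fun j _ => div_nonneg (hβ0 j) (by positivity)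
      simp only [mul_one_div]
      linarith
    filter_upwards [h1.eventually (gt_mem_nhds h2)] with n hn
    have hpos := hγ.pos n
    rw [← div_le_iff₀ hpos, Finset.sum_div]
    refine le_of_eq_of_le (Finset.sum_congr rfl fun j _ => ?_) hn.le
    rw [mul_div_assoc]
  -- Remote lags involve only the fixed values `z 0, …, z p`, so their share is a multiple of `γ n`
  -- independent of the bound being propagated.
  set K₀ := C * (∑ i ∈ Finset.range (p + 1), z i * (1 / r ^ i) + 1) with hK₀
  have hK₀0 : 0 < K₀ := mul_pos hC0 (add_pos_of_nonneg_of_pos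
    (Finset.sum_nonneg fun i _ => mul_nonneg (hz i) (by positivity)) one_pos)
  have hrem : ∀ᶠ n in atTop,
      ∑ i ∈ Finset.range (p + 1), C * γ (n - i) * z i ≤ K₀ * γ n := by
    have h1 : Tendsto (fun n => ∑ i ∈ Finset.range (p + 1), z i * (γ (n - i) / γ n)) atTop
        (𝓝 (∑ i ∈ Finset.range (p + 1), z i * (1 / r ^ i))) :=
      tendsto_finsetSum _ fun i _ => (hγ.tendsto_ratio i).const_mul (z i)
    filter_upwards [h1.eventually (gt_mem_nhds (lt_add_one _))] with n hn
    have hpos := hγ.pos n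
    rw [← div_le_iff₀ hpos, Finset.sum_div]
    refine le_trans (le_of_eq ?_) (mul_le_mul_of_nonneg_left hn.le hC0.le)
    rw [Finset.mul_sum]
    exact Finset.sum_congr rfl fun i _ => by ring
  obtain ⟨N, hN⟩ := eventually_atTop.1
    (hp.and (hrec.and (hrem.and (eventually_ge_atTop (2 * (p + 1))))))
  have hstep : ∀ n, N ≤ n → ∀ M, 0 ≤ M → (∀ k < n, z k ≤ M * γ k) →
      z n ≤ (M * (q₀ + 2 * δ) + K₀) * γ n := by
    intro n hn M hM hk
    obtain ⟨h1, h2, h3, h4⟩ := hN n hn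
    rw [h.eq_split h4]
    have b1 : ∑ j ∈ Finset.range p, β j * z (n - (j + 1)) ≤ M * ((q₀ + δ) * γ n) := by
      refine le_trans ?_ (mul_le_mul_of_nonneg_left h2 hM)
      rw [Finset.mul_sum]
      refine Finset.sum_le_sum fun j _ => ?_
      have := mul_le_mul_of_nonneg_left (hk (n - (j + 1)) (by omega)) (hβ0 j)
      linarith
    have b2 : ∑ j ∈ Finset.Ico p (n - (p + 1)), β j * z (n - (j + 1)) ≤ M * δ * γ n := by
      have e : ∑ i ∈ Finset.Icc (p + 1) (n - (p + 1)), γ (n - i) * γ i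
          = ∑ j ∈ Finset.Ico p (n - (p + 1)), γ (n - (j + 1)) * γ (j + 1) := by
        rw [Finset.sum_Ico_add' (fun i => γ (n - i) * γ i)]
        rfl
      have h5 := mul_le_mul_of_nonneg_left h1 (mul_nonneg hM hC0.le)
      have h6 : M * C * (δ / C * γ n) = M * δ * γ n := by field_simp
      rw [h6, e, Finset.mul_sum] at h5
      refine le_trans (Finset.sum_le_sum fun j _ => ?_) h5
      have := mul_le_mul (hC j) (hk (n - (j + 1)) (by omega)) (hz _)
        (mul_nonneg hC0.le (hγ.pos _).le)
      linarith
    have b3 : ∑ i ∈ Finset.range (p + 1), β (n - (i + 1)) * z i ≤ K₀ * γ n := by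
      refine le_trans (Finset.sum_le_sum fun i hi => ?_) h3
      have hi := Finset.mem_range.1 hi
      have h7 := hC (n - (i + 1))
      have h8 : n - (i + 1) + 1 = n - i := by omega
      rw [h8] at h7
      exact mul_le_mul_of_nonneg_right h7 (hz i)
    linarith
  have hq : 0 < 1 - (q₀ + 2 * δ) := by rw [hδ]; linarith
  have hS : 0 ≤ ∑ k ∈ Finset.range N, z k / γ k :=
    Finset.sum_nonneg fun k _ => div_nonneg (hz k) (hγ.pos k).le
  -- The sum covers `n < N`; the second term is the fixed point of `M ↦ M * (q₀ + 2 * δ) + K₀`, so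
  -- `hstep` preserves the bound `K`.
  set K := ∑ k ∈ Finset.range N, z k / γ k + K₀ / (1 - (q₀ + 2 * δ)) with hK
  have hKpos : 0 < K := add_pos_of_nonneg_of_pos hS (div_pos hK₀0 hq)
  have hKge : K * (q₀ + 2 * δ) + K₀ ≤ K := by
    have : K₀ / (1 - (q₀ + 2 * δ)) ≤ K := by rw [hK]; linarith
    have := (div_le_iff₀ hq).1 this
    linarith
  refine ⟨K, hKpos, fun n => ?_⟩
  induction n using Nat.strong_induction_on with
  | _ n ih =>
    rcases lt_or_ge n N with hn | hn
    · have h1 := Finset.single_le_sum (f := fun k => z k / γ k)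
        (fun k _ => div_nonneg (hz k) (hγ.pos k).le) (Finset.mem_range.2 hn)
      rw [← div_le_iff₀ (hγ.pos n)]
      have := div_pos hK₀0 hq
      linarith
    · exact (hstep n hn K hKpos.le ih).trans
        (mul_le_mul_of_nonneg_right hKge (hγ.pos n).le)

/-- Both quotients of `γ` and its monotone companion converge, hence are bounded over all indices;
compare through the companion. -/
theorem InWDown.exists_shift_le {r : ℝ} {γ : ℕ → ℝ} (h : InWDown r γ) :
    ∃ K, 0 < K ∧ ∀ n j, γ (n + j) ≤ K * γ n := by
  obtain ⟨hγ, g, hg, hmono, hlim⟩ := h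
  have hanti : Antitone g := antitone_nat_of_succ_le hmono
  have hlim' : Tendsto (fun n => (γ n / g n)⁻¹) atTop (𝓝 1⁻¹) := hlim.inv₀ one_ne_zero
  obtain ⟨A, hA⟩ := hlim.bddAbove_range
  obtain ⟨B, hB⟩ := hlim'.bddAbove_range
  have hA' : ∀ n, γ n ≤ A * g n := fun n =>
    (div_le_iff₀ (hg n)).1 (hA (Set.mem_range_self n))
  have hB' : ∀ n, g n ≤ B * γ n := fun n => by
    have := hB (Set.mem_range_self n)
    simp only [inv_div] at this
    exact (div_le_iff₀ (hγ.pos n)).1 this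
  have hA0 : 0 < A := lt_of_lt_of_le (div_pos (hγ.pos 0) (hg 0)) (hA (Set.mem_range_self 0))
  have hB0 : 0 < B := lt_of_lt_of_le (inv_pos.2 (div_pos (hγ.pos 0) (hg 0)))
    (hB (Set.mem_range_self 0))
  refine ⟨A * B, mul_pos hA0 hB0, fun n j => ?_⟩
  calc γ (n + j) ≤ A * g (n + j) := hA' _
    _ ≤ A * g n := mul_le_mul_of_nonneg_left (hanti (Nat.le_add_right n j)) hA0.le
    _ ≤ A * (B * γ n) := mul_le_mul_of_nonneg_left (hB' n) hA0.le
    _ = A * B * γ n := by ring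

/-- Equivalence of the decay of a renewal kernel and of the autocorrelation of the solution. -/
theorem IsRenewal.weight_iff {β z γ : ℕ → ℝ} {r v : ℝ} (h : IsRenewal β z)
    (hγ : InWDown r γ) (hr : 0 < r) (hβ0 : ∀ j, 0 ≤ β j) (hz : Summable z) (hv : 0 < v) :
    ((Summable (fun j => β j / r ^ (j + 1)) ∧ ∑' j, β j / r ^ (j + 1) < 1) ∧
        ∃ C, 0 < C ∧ ∀ j, β j ≤ C * γ (j + 1)) ↔
      ∃ C, 0 < C ∧ ∀ n : ℕ, v * autocorr z n ≤ C * γ n := by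
  have hz0 := h.nonneg hβ0
  have hsum : ∀ n, Summable fun i => z i * z (i + n) := fun n => by
    obtain ⟨M, hM⟩ := exists_bound_of_summable hz
    exact summable_mul_bounded hz fun i => hM _
  constructor
  · rintro ⟨⟨hs, hlt⟩, C, hC0, hC⟩
    obtain ⟨K, hK0, hK⟩ := h.exists_le_weight hγ.1 hr hβ0 hs hlt hC0 hC
    obtain ⟨L, hL0, hL⟩ := hγ.exists_shift_le
    have hS : 0 ≤ ∑' i, z i := tsum_nonneg hz0
    refine ⟨v * (K * L * (∑' i, z i + 1)), by positivity, fun n => ?_⟩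
    rw [mul_assoc]
    refine mul_le_mul_of_nonneg_left ?_ hv.le
    have hγn := (hγ.1.pos n).le
    rw [autocorr_natCast]
    calc ∑' i, z i * z (i + n) ≤ ∑' i, z i * (K * L * γ n) := by
          refine (hsum n).tsum_le_tsum (fun i => ?_) (hz.mul_right _)
          refine mul_le_mul_of_nonneg_left ?_ (hz0 i)
          refine (hK _).trans ?_
          rw [mul_assoc, add_comm]
          exact mul_le_mul_of_nonneg_left (hL n i) hK0.le
      _ = K * L * (∑' i, z i) * γ n := by rw [tsum_mul_right]; ring
      _ ≤ K * L * (∑' i, z i + 1) * γ n := by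
          refine mul_le_mul_of_nonneg_right ?_ hγn
          exact mul_le_mul_of_nonneg_left (by linarith) (by positivity)
  · rintro ⟨C, hC0, hC⟩
    have hzγ : ∀ n, z n ≤ C / v * γ n := by
      intro n
      have h1 : z n ≤ autocorr z n := by
        rw [autocorr_natCast]
        have := (hsum n).le_tsum 0 fun i _ => mul_nonneg (hz0 _) (hz0 _)
        simpa [h.1] using this
      have h2 := (mul_le_mul_of_nonneg_left h1 hv.le).trans (hC n)
      rw [div_mul_eq_mul_div, le_div_iff₀ hv]
      linarith
    refine ⟨?_, C / v, div_pos hC0 hv, fun j => (h.le hβ0 j).trans (hzγ _)⟩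
    have hs : Summable fun n => z n * (1 / r) ^ n := by
      refine (hγ.1.summable.mul_left (C / v)).of_nonneg_of_le
        (fun n => mul_nonneg (hz0 n) (by positivity)) fun n => ?_
      have := mul_le_mul_of_nonneg_right (hzγ n) (by positivity : 0 ≤ (1 / r) ^ n)
      refine this.trans (le_of_eq ?_)
      rw [one_div_pow]; ring
    have := h.tsum_lt_one hβ0 (one_div_pos.2 hr) hs
    simpa only [one_div_pow, mul_one_div] using this

/-! ### Moments and covariances of the ARCH process. -/

/-- The volatility `a + ∑_{j ≥ 1} b(j) X(k - j)` of an ARCH(∞) process. -/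
noncomputable def archVolatility {Ω : Type*} (a : ℝ) (b : ℕ → ℝ) (X : ℤ → Ω → ℝ) (k : ℤ)
    (ω : Ω) : ℝ :=
  a + ∑' j : ℕ, b (j + 1) * X (k - (j + 1)) ω

theorem measurable_past_filter (b : ℕ → ℝ) (k : ℤ) : Measurable
    fun x : {j : ℤ // j < k} → ℝ => ∑' j : ℕ, b (j + 1) * x ⟨k - (j + 1), by omega⟩ := by
  refine Measurable.tsum fun j => Measurable.const_mul ?_ _
  exact measurable_pi_apply _

section Arch

variable {Ω : Type*} [MeasurableSpace Ω] {P : Measure Ω} {a : ℝ} {b : ℕ → ℝ}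
  {ξ X : ℤ → Ω → ℝ} {ρ : ℤ → ℝ}

theorem IsArchSolution.measurable_volatility (hX : IsArchSolution P a b ξ X) (k : ℤ) :
    Measurable (archVolatility a b X k) :=
  (Measurable.tsum fun _ => (hX.measurable _).const_mul _).const_add a

theorem IsArchSolution.indepFun_volatility (hX : IsArchSolution P a b ξ X) (k : ℤ) :
    IndepFun (ξ k) (archVolatility a b X k) P := by
  let φ : ({j : ℤ // j < k} → ℝ) → ℝ :=
    fun x => a + ∑' j : ℕ, b (j + 1) * x ⟨k - (j + 1), by omega⟩
  have hφ : Measurable φ :=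
    (measurable_past_filter b k).const_add a
  exact (hX.nonanticipative k).comp measurable_id hφ

theorem IsArchSolution.indepFun_mul_volatility (hX : IsArchSolution P a b ξ X) {l k : ℤ}
    (hlk : l < k) : IndepFun (ξ k) (fun ω => X l ω * archVolatility a b X k ω) P := by
  let φ : ({j : ℤ // j < k} → ℝ) → ℝ :=
    fun x => x ⟨l, hlk⟩ * (a + ∑' j : ℕ, b (j + 1) * x ⟨k - (j + 1), by omega⟩)
  have hφ : Measurable φ := (measurable_pi_apply _).mul
    ((measurable_past_filter b k).const_add a)
  exact (hX.nonanticipative k).comp measurable_id hφ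

theorem IsShockSequence.integral_eq (hξ : IsShockSequence P ξ) (k : ℤ) :
    ∫ ω, ξ k ω ∂P = ∫ ω, ξ 0 ω ∂P :=
  (hξ.identDistrib k).integral_eq

theorem IsShockSequence.integral_sq_eq (hξ : IsShockSequence P ξ) (k : ℤ) :
    ∫ ω, ξ k ω ^ 2 ∂P = ∫ ω, ξ 0 ω ^ 2 ∂P :=
  (hξ.identDistrib k).sq.integral_eq

/-- `X² = ς² ξ²` is integrable with independent factors, and `ξ` is not almost surely zero, so `ς²`
is itself integrable. -/
theorem IsArchSolution.memLp_volatility (hξ : IsShockSequence P ξ)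
    (hX : IsArchSolution P a b ξ X) (hρ : IsWeaklyStationary P X ρ)
    (hpos : 0 < ∫ ω, ξ 0 ω ∂P) (k : ℤ) : MemLp (archVolatility a b X k) 2 P := by
  have hm := hX.measurable_volatility k
  rw [memLp_two_iff_integrable_sq hm.aestronglyMeasurable]
  have hind : IndepFun (fun ω => archVolatility a b X k ω ^ 2) (fun ω => ξ k ω ^ 2) P :=
    (hX.indepFun_volatility k).symm.comp (measurable_id.pow_const 2) (measurable_id.pow_const 2)
  refine hind.integrable_left_of_integrable_op (fun x y => x * y) 1 one_ne_zero ?_ ?_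
    (hm.pow_const 2).aestronglyMeasurable
    ((hξ.measurable k).pow_const 2).aestronglyMeasurable ?_
  · intro x y
    simp [enorm_mul]
  · refine (hρ.memLp k).integrable_sq.congr ?_
    filter_upwards [hX.equation k] with ω hω
    rw [hω, mul_pow]; rfl
  · intro h0
    rw [← hξ.integral_eq k] at hpos
    refine hpos.ne' (integral_eq_zero_of_ae ?_)
    filter_upwards [h0] with ω hω
    simpa using hω

theorem IsArchSolution.integral_eq (hξ : IsShockSequence P ξ) (hX : IsArchSolution P a b ξ X)
    (k : ℤ) : ∫ ω, X k ω ∂P = (∫ ω, ξ 0 ω ∂P) * ∫ ω, archVolatility a b X k ω ∂P := by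
  rw [← hξ.integral_eq k, ← (hX.indepFun_volatility k).integral_fun_mul_eq_mul_integral
    (hξ.measurable k).aestronglyMeasurable (hX.measurable_volatility k).aestronglyMeasurable]
  refine integral_congr_ae ?_
  filter_upwards [hX.equation k] with ω hω
  rw [hω, mul_comm]; rfl

theorem IsWeaklyStationary.variance_eq (hρ : IsWeaklyStationary P X ρ) (k : ℤ) :
    variance (X k) P = ρ 0 := by
  rw [hρ.cov k 0, add_zero, covariance_self (hρ.memLp k).aestronglyMeasurable.aemeasurable]

theorem IsWeaklyStationary.neg (hρ : IsWeaklyStationary P X ρ) (k : ℤ) : ρ (-k) = ρ k := by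
  rw [hρ.cov k (-k), hρ.cov 0 k, covariance_comm]
  simp

variable [IsProbabilityMeasure P]

/-- The variances `2ρ(0) ± 2ρ(k)` of `X 0 ± X k` are non-negative. -/
theorem IsWeaklyStationary.abs_le (hρ : IsWeaklyStationary P X ρ) (k : ℤ) : |ρ k| ≤ ρ 0 := by
  have h1 := variance_add (hρ.memLp 0) (hρ.memLp (0 + k))
  have h2 := variance_sub (hρ.memLp 0) (hρ.memLp (0 + k))
  have h3 := variance_nonneg (X 0 + X (0 + k)) P
  have h4 := variance_nonneg (X 0 - X (0 + k)) P
  rw [← hρ.cov, hρ.variance_eq, hρ.variance_eq] at h1 h2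
  rw [_root_.abs_le]
  constructor <;> linarith

theorem IsWeaklyStationary.exists_integral_sq_eq (hρ : IsWeaklyStationary P X ρ) :
    ∃ s, ∀ k, ∫ ω, X k ω ^ 2 ∂P = s := by
  obtain ⟨m, hm⟩ := hρ.mean
  refine ⟨ρ 0 + m ^ 2, fun k => ?_⟩
  have := variance_eq_sub (hρ.memLp k)
  rw [hρ.variance_eq, hm] at this
  simp only [Pi.pow_apply] at this
  linarith

/-- Integration against the linear filter of the past of a stationary process is termwise. -/
theorem IsWeaklyStationary.hasSum_integral_mul (hρ : IsWeaklyStationary P X ρ)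
    (hb : ∀ j : ℕ, 0 ≤ b (j + 1)) (hs : Summable fun j : ℕ => b (j + 1))
    {Y : Ω → ℝ} (hY : MemLp Y 2 P) (k : ℤ) :
    HasSum (fun j : ℕ => b (j + 1) * ∫ ω, Y ω * X (k - (j + 1)) ω ∂P)
      (∫ ω, Y ω * ∑' j : ℕ, b (j + 1) * X (k - (j + 1)) ω ∂P) := by
  obtain ⟨s, hsq⟩ := hρ.exists_integral_sq_eq
  have hint : ∀ j : ℕ, Integrable (fun ω => Y ω * X (k - (j + 1)) ω) P :=
    fun j => hY.integrable_mul (hρ.memLp _)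
  have h := hasSum_integral_of_summable_integral_norm (μ := P)
    (F := fun (j : ℕ) ω => b (j + 1) * (Y ω * X (k - (j + 1)) ω))
    (fun j => (hint j).const_mul _) ?_
  · simp_rw [integral_const_mul] at h
    refine Eq.subst (motive := fun f => HasSum _ (∫ ω, f ω ∂P)) (funext fun ω => ?_) h
    rw [← tsum_mul_left]
    exact tsum_congr fun j => by ring
  -- Uses `|Y X| ≤ (Y² + X²) / 2` and the common second moment `s`.
  · refine (hs.mul_right ((∫ ω, Y ω ^ 2 ∂P + s) / 2)).of_nonneg_of_le
      (fun j => integral_nonneg fun ω => norm_nonneg _) fun j => ?_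
    simp_rw [norm_mul (b (j + 1)), Real.norm_of_nonneg (hb j)]
    rw [integral_const_mul]
    refine mul_le_mul_of_nonneg_left ?_ (hb j)
    rw [← hsq (k - (j + 1)), ← integral_add hY.integrable_sq (hρ.memLp _).integrable_sq,
      ← integral_div]
    refine integral_mono (hint j).norm
      ((hY.integrable_sq.add (hρ.memLp _).integrable_sq).div_const 2) fun ω => ?_
    simp only [norm_mul, Real.norm_eq_abs]
    nlinarith [sq_nonneg (|Y ω| - |X (k - (j + 1)) ω|), sq_abs (Y ω),
      sq_abs (X (k - (j + 1)) ω)]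

theorem IsArchSolution.covariance_volatility (hξ : IsShockSequence P ξ)
    (hX : IsArchSolution P a b ξ X) (hρ : IsWeaklyStationary P X ρ)
    (hpos : 0 < ∫ ω, ξ 0 ω ∂P) (hb : ∀ j : ℕ, 0 ≤ b (j + 1))
    (hs : Summable fun j : ℕ => b (j + 1)) {Y : Ω → ℝ} (hY : MemLp Y 2 P) (k : ℤ) :
    covariance Y (archVolatility a b X k) P
      = ∑' j : ℕ, b (j + 1) * covariance Y (X (k - (j + 1))) P := by
  have hV := hX.memLp_volatility hξ hρ hpos k
  have hV' : MemLp (fun ω => ∑' j : ℕ, b (j + 1) * X (k - (j + 1)) ω) 2 P := by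
    refine (hV.sub (memLp_const a)).congr_norm ?_ ?_
    · exact (Measurable.tsum fun _ => (hX.measurable _).const_mul _).aestronglyMeasurable
    · exact Eventually.of_forall fun ω => by simp [archVolatility]
  have h1 := hρ.hasSum_integral_mul hb hs hY k
  -- The case `Y = 1` gives the mean of the filter, needed to centre `h1`.
  have h2 := hρ.hasSum_integral_mul hb hs (memLp_const (1 : ℝ)) k
  have h3 := h1.sub (h2.mul_left (∫ ω, Y ω ∂P))
  have h4 : covariance Y (archVolatility a b X k) P
      = covariance Y (fun ω => ∑' j : ℕ, b (j + 1) * X (k - (j + 1)) ω) P :=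
    covariance_const_add_right (hV'.integrable one_le_two) a
  rw [h4, covariance_eq_sub hY hV']
  simp only [one_mul] at h3
  refine h3.tsum_eq.symm.trans (tsum_congr fun j => ?_)
  rw [covariance_eq_sub hY (hρ.memLp _)]
  simp only [Pi.mul_apply]
  ring

/-- The covariance with an earlier value sees the volatility only. -/
theorem IsArchSolution.covariance_of_lt (hξ : IsShockSequence P ξ)
    (hX : IsArchSolution P a b ξ X) (hρ : IsWeaklyStationary P X ρ)
    (hpos : 0 < ∫ ω, ξ 0 ω ∂P) {l k : ℤ} (hlk : l < k) :
    covariance (X l) (X k) P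
      = (∫ ω, ξ 0 ω ∂P) * covariance (X l) (archVolatility a b X k) P := by
  rw [covariance_eq_sub (hρ.memLp l) (hρ.memLp k),
    covariance_eq_sub (hρ.memLp l) (hX.memLp_volatility hξ hρ hpos k), hX.integral_eq hξ k]
  have h : ∫ ω, X l ω * X k ω ∂P
      = (∫ ω, ξ 0 ω ∂P) * ∫ ω, X l ω * archVolatility a b X k ω ∂P := by
    rw [← hξ.integral_eq k, ← (hX.indepFun_mul_volatility hlk).integral_fun_mul_eq_mul_integral
      (hξ.measurable k).aestronglyMeasurable
      ((hX.measurable l).mul (hX.measurable_volatility k)).aestronglyMeasurable]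
    refine integral_congr_ae ?_
    filter_upwards [hX.equation k] with ω hω
    rw [hω, archVolatility]; ring
  simp only [Pi.mul_apply, h]
  ring

/-- Independence gives `E X² = E ξ² · E ς²` and `E[X ς] = E ξ · E ς²`. The first summand becomes the
lag-zero term `v` of Yule-Walker. -/
theorem IsArchSolution.variance_eq_add (hξ : IsShockSequence P ξ)
    (hX : IsArchSolution P a b ξ X) (hρ : IsWeaklyStationary P X ρ)
    (hpos : 0 < ∫ ω, ξ 0 ω ∂P) (k : ℤ) :
    variance (X k) P = variance (ξ 0) P * (∫ ω, archVolatility a b X k ω ^ 2 ∂P)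
      + (∫ ω, ξ 0 ω ∂P) * covariance (X k) (archVolatility a b X k) P := by
  have hm := hX.measurable_volatility k
  rw [variance_eq_sub (hρ.memLp k), variance_eq_sub hξ.memLp,
    covariance_eq_sub (hρ.memLp k) (hX.memLp_volatility hξ hρ hpos k), hX.integral_eq hξ k]
  have h1 : ∫ ω, X k ω ^ 2 ∂P
      = (∫ ω, ξ 0 ω ^ 2 ∂P) * ∫ ω, archVolatility a b X k ω ^ 2 ∂P := by
    have hind : IndepFun (fun ω => ξ k ω ^ 2) (fun ω => archVolatility a b X k ω ^ 2) P :=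
      (hX.indepFun_volatility k).comp (measurable_id.pow_const 2) (measurable_id.pow_const 2)
    rw [← hξ.integral_sq_eq k, ← hind.integral_fun_mul_eq_mul_integral
      ((hξ.measurable k).pow_const 2).aestronglyMeasurable
      (hm.pow_const 2).aestronglyMeasurable]
    refine integral_congr_ae ?_
    filter_upwards [hX.equation k] with ω hω
    rw [hω, archVolatility]; ring
  have h2 : ∫ ω, X k ω * archVolatility a b X k ω ∂P
      = (∫ ω, ξ 0 ω ∂P) * ∫ ω, archVolatility a b X k ω ^ 2 ∂P := by
    have hind : IndepFun (ξ k) (fun ω => archVolatility a b X k ω ^ 2) P :=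
      (hX.indepFun_volatility k).comp measurable_id (measurable_id.pow_const 2)
    rw [← hξ.integral_eq k, ← hind.integral_fun_mul_eq_mul_integral
      (hξ.measurable k).aestronglyMeasurable (hm.pow_const 2).aestronglyMeasurable]
    refine integral_congr_ae ?_
    filter_upwards [hX.equation k] with ω hω
    rw [hω, archVolatility]; ring
  simp only [Pi.mul_apply, Pi.pow_apply, h1, h2]
  ring

/-- If `ς` vanished almost surely, `X` would have mean zero, and so would the filter of its past,
which would however equal `-a`. -/
theorem IsArchSolution.integral_volatility_sq_pos (hξ : IsShockSequence P ξ)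
    (hX : IsArchSolution P a b ξ X) (hρ : IsWeaklyStationary P X ρ)
    (hpos : 0 < ∫ ω, ξ 0 ω ∂P) (ha : 0 < a) (hb : ∀ j : ℕ, 0 ≤ b (j + 1))
    (hs : Summable fun j : ℕ => b (j + 1)) (k : ℤ) :
    0 < ∫ ω, archVolatility a b X k ω ^ 2 ∂P := by
  have hV := hX.memLp_volatility hξ hρ hpos k
  have hnn : 0 ≤ ∫ ω, archVolatility a b X k ω ^ 2 ∂P := integral_nonneg fun ω => sq_nonneg _
  refine lt_of_le_of_ne hnn fun h0 => ?_
  have hzero : (fun ω => archVolatility a b X k ω ^ 2) =ᵐ[P] 0 :=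
    (integral_eq_zero_iff_of_nonneg (fun ω => sq_nonneg _) hV.integrable_sq).1 h0.symm
  have hae : archVolatility a b X k =ᵐ[P] 0 := by
    filter_upwards [hzero] with ω hω
    simpa using hω
  obtain ⟨m, hm⟩ := hρ.mean
  have hm0 : m = 0 := by
    rw [← hm k, hX.integral_eq hξ k, integral_eq_zero_of_ae hae, mul_zero]
  have h1 := (hρ.hasSum_integral_mul hb hs (memLp_const (1 : ℝ)) k).tsum_eq
  simp only [one_mul, hm, hm0, mul_zero, tsum_zero] at h1
  have h2 : ∫ ω, ∑' j : ℕ, b (j + 1) * X (k - (j + 1)) ω ∂P = ∫ _, (-a) ∂P := by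
    refine integral_congr_ae ?_
    filter_upwards [hae] with ω hω
    simp only [archVolatility, Pi.zero_apply] at hω
    linarith
  rw [← h1] at h2
  simp at h2
  linarith

/-- The Yule-Walker equations of a stationary ARCH(∞) process. -/
theorem IsArchSolution.exists_yuleWalker (hξ : IsShockSequence P ξ)
    (hX : IsArchSolution P a b ξ X) (hρ : IsWeaklyStationary P X ρ)
    (hpos : 0 < ∫ ω, ξ 0 ω ∂P) (hvar : 0 < variance (ξ 0) P) (ha : 0 < a)
    (hb : ∀ j : ℕ, 0 ≤ b (j + 1)) (hs : Summable fun j : ℕ => b (j + 1)) :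
    ∃ v, 0 < v ∧ ∀ k : ℤ, 0 ≤ k → ρ k = (if k = 0 then v else 0) +
      ∑' j : ℕ, (∫ ω, ξ 0 ω ∂P) * b (j + 1) * ρ (k - (j + 1)) := by
  refine ⟨_, mul_pos hvar (hX.integral_volatility_sq_pos hξ hρ hpos ha hb hs 0), fun k hk => ?_⟩
  have hcov : (∫ ω, ξ 0 ω ∂P) * covariance (X 0) (archVolatility a b X k) P
      = ∑' j : ℕ, (∫ ω, ξ 0 ω ∂P) * b (j + 1) * ρ (k - (j + 1)) := by
    rw [hX.covariance_volatility hξ hρ hpos hb hs (hρ.memLp 0), ← tsum_mul_left]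
    refine tsum_congr fun j => ?_
    rw [hρ.cov 0, zero_add, mul_assoc]
  rw [← hcov]
  split_ifs with h0
  · subst h0
    rw [← hX.variance_eq_add hξ hρ hpos, hρ.variance_eq]
  · rw [zero_add, ← hX.covariance_of_lt hξ hρ hpos (by omega), hρ.cov 0, zero_add]

end Arch

theorem theorem5p3 {Ω : Type*} [MeasurableSpace Ω] (P : Measure Ω) [IsProbabilityMeasure P]
    (a : ℝ) (b : ℕ → ℝ) (ξ X : ℤ → Ω → ℝ) (ρ : ℤ → ℝ) (lam1 σ : ℝ) (z : ℕ → ℝ)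
    -- the data and the standing assumptions
    (hξ : IsShockSequence P ξ)
    (hlam1 : lam1 = ∫ ω, ξ 0 ω ∂P) (hlam1_pos : 0 < lam1)
    (hσ : σ = Real.sqrt (variance (ξ 0) P)) (hσ_pos : 0 < σ)
    (ha : 0 < a) (hb : ∀ j, 1 ≤ j → 0 ≤ b j) (hb0 : ∃ j, 1 ≤ j ∧ b j ≠ 0)
    -- the stationary solution and its autocovariance function
    (hX : IsArchSolution P a b ξ X) (hρ : IsWeaklyStationary P X ρ)
    -- first condition
    (hS1 : Summable (fun j : ℕ => b (j + 1)) ∧ lam1 * ∑' j : ℕ, b (j + 1) < 1)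
    -- second condition
    (hz : IsReciprocalCoeffs lam1 b z)
    (hS2 : Summable (fun j : ℕ => z (j + 1) ^ 2) ∧
      σ / lam1 * Real.sqrt (∑' j : ℕ, z (j + 1) ^ 2) < 1)
    (r : ℝ) (hr0 : 0 < r) (hr1 : r ≤ 1) (γ : ℕ → ℝ) (hγ : InWDown r γ) :
    (WeightedSumLtOne lam1 b r ∧ ∃ C₀ : ℝ, 0 < C₀ ∧ ∀ n : ℕ, 1 ≤ n → b n ≤ C₀ * γ n) ↔
      (∃ C₂ : ℝ, 0 < C₂ ∧ ∀ n : ℕ, ρ n ≤ C₂ * γ n) := by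
  have hb' : ∀ j : ℕ, 0 ≤ b (j + 1) := fun j => hb _ (by omega)
  have hvar : 0 < variance (ξ 0) P := Real.sqrt_pos.1 (hσ ▸ hσ_pos)
  obtain ⟨v, hv, hyw⟩ := hX.exists_yuleWalker hξ hρ (hlam1 ▸ hlam1_pos) hvar ha hb' hS1.1
  rw [← hlam1] at hyw
  have hren : IsRenewal (fun j => lam1 * b (j + 1)) z := hz.rec hlam1_pos.le hb hS1.1 hS1.2
  have hβ0 : ∀ j : ℕ, 0 ≤ lam1 * b (j + 1) := fun j => mul_nonneg hlam1_pos.le (hb' j)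
  have hρz := hren.eq_autocorr hβ0 (hS1.1.mul_left lam1) (by rw [tsum_mul_left]; exact hS1.2)
    hz.summable hρ.abs_le hρ.neg hyw
  simp only [hρz]
  rw [← hren.weight_iff hγ hr0 hβ0 hz.summable hv]
  refine and_congr ?_ ?_
  · simp only [WeightedSumLtOne, mul_div_assoc, tsum_mul_left, summable_mul_left_iff hlam1_pos.ne']
  · constructor
    · rintro ⟨C, hC0, hC⟩
      refine ⟨lam1 * C, mul_pos hlam1_pos hC0, fun j => ?_⟩
      rw [mul_assoc]
      exact mul_le_mul_of_nonneg_left (hC _ (by omega)) hlam1_pos.le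
    · rintro ⟨C, hC0, hC⟩
      refine ⟨C / lam1, div_pos hC0 hlam1_pos, fun n hn => ?_⟩
      obtain ⟨j, rfl⟩ : ∃ j, n = j + 1 := ⟨n - 1, by omega⟩
      rw [div_mul_eq_mul_div, le_div_iff₀ hlam1_pos, mul_comm]
      exact hC j
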